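/- Conventions: for a vector $x\in\mathbb R^n$, $\|x\|_1=\sum_i|x_i|$ and $\|x\|_\infty=\max_i|x_i|$; for a matrix $M\in\mathbb R^{n\times n}$, $\|M\|_1=\sum_{i,j}|M_{ij}|$, $\|M\|_\infty=\max_{i,j}|M_{ij}|$ and $\|M\|_F^2=\sum_{i,j}M_{ij}^2$. Let $A\in\mathbb R^{m\times n}$ have a nontrivial null space (for example $n>m$), let $k\ge 1$ be a real number (in particular, any positive integer) and let $\epsilon>0$. Put $$\alpha_k=\max\{\,y^Tx:\ x,y\in\mathbb R^n,\ Ax=0,\ \|x\|_1=1,\ \|y\|_\infty=1,\ \|y\|_1\le k\,\}$$ and let $SDP_k$ be the optimal value of the semidefinite program in the variables $X=X^T,\ Y=Y^T,\ Z\in\mathbb R^{n\times n}$ $$\text{maximize } \operatorname{Tr}(Z)\quad\text{subject to}\quad AXA^T=0,\ \|X\|_1\le 1,\ \|Y\|_\infty\le 1,\ \|Y\|_1\le k^2,\ \|Z\|_1\le k,\quad \Gamma=\begin{pmatrix}X&Z^T\\ Z&Y\end{pmatrix}\succeq 0 .$$ Both maxima are attained, and $\alpha_k\le SDP_k$. Moreover,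 let $(X,Y,Z)$ be any optimal solution of the semidefinite program, and set $$\delta=3+\frac{3\left(\|Z\|_F^2+\operatorname{Tr}(XY)\right)}{\epsilon^2},\qquad g(X,\delta)=\left(\sqrt{2/\pi}+\sqrt{2\log\delta}\right)\sum_{i=1}^n\sqrt{X_{ii}},$$ $$h(Y,n,k,\delta)=\max\left\{\left(\sqrt{2\log (2n)}+\sqrt{2\log\delta}\right)\max_{1\le i\le n}\sqrt{Y_{ii}},\ \frac{\left(\sqrt{2/\pi}+\sqrt{2\log\delta}\right)\sum_{i=1}^n\sqrt{Y_{ii}}}{k}\right\}.$$ Then $g(X,\delta)>0$, $h(Y,n,k,\delta)>0$ and $$\frac{SDP_k-\epsilon}{g(X,\delta)\,h(Y,n,k,\delta)}\ \le\ \alpha_k .$$ Furthermore this lower bound is reached by Gaussian randomization: if $(x,y)\sim\mathcal N(0,\Gamma)$, then with positive probability the rescaled point $(\bar x,\bar y)=\left(x/g(X,\delta),\ y/h(Y,n,k,\delta)\right)$ satisfies $A\bar x=0$, $\|\bar x\|_1\le 1$, $\|\bar y\|_\infty\le 1$, $\|\bar y\|_1\le k$ and $$\bar y^T\bar x\ \ge\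 \frac{SDP_k-\epsilon}{g(X,\delta)\,h(Y,n,k,\delta)}.$$ -/

import Mathlib

open Matrix MeasureTheory ProbabilityTheory

noncomputable section

namespace SparseRecovery

/-- The `ℓ¹` norm of a vector. (The `ℓ^∞` norm is the norm `‖y‖` of `Fin n → ℝ`.) -/
def l1 {n : ℕ} (x : Fin n → ℝ) : ℝ := ∑ i, |x i|

/-- The sum of the absolute values of the entries of a matrix. -/
def entryL1 {n : ℕ} (M : Matrix (Fin n) (Fin n) ℝ) : ℝ := ∑ i, ∑ j, |M i j|

/-- The largest absolute value of an entry of a matrix. -/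
def entrySup {n : ℕ} (M : Matrix (Fin n) (Fin n) ℝ) : ℝ :=
  ⨆ p : Fin n × Fin n, |M p.1 p.2|

/-- The square of the Frobenius norm. -/
def frobSq {n : ℕ} (M : Matrix (Fin n) (Fin n) ℝ) : ℝ := ∑ i, ∑ j, M i j ^ 2

/-- The values `yᵀx` over all `x` with `Ax = 0`, `‖x‖₁ = 1` and all `y` with `‖y‖_∞ = 1`,
`‖y‖₁ ≤ k`. -/
def alphaValues {m n : ℕ} (A : Matrix (Fin m) (Fin n) ℝ) (k : ℝ) : Set ℝ :=
  {t | ∃ x y : Fin n → ℝ, A *ᵥ x = 0 ∧ l1 x = 1 ∧ ‖y‖ = 1 ∧ l1 y ≤ k ∧ t = y ⬝ᵥ x}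

/-- The constant `α_k` of the matrix `A`. -/
def alpha {m n : ℕ} (A : Matrix (Fin m) (Fin n) ℝ) (k : ℝ) : ℝ := sSup (alphaValues A k)

/-- The block matrix `Γ` with rows `(X, Zᵀ)` and `(Z, Y)`. -/
def blockGamma {n : ℕ} (X Y Z : Matrix (Fin n) (Fin n) ℝ) :
    Matrix (Fin n ⊕ Fin n) (Fin n ⊕ Fin n) ℝ :=
  Matrix.fromBlocks X Zᵀ Z Y

/-- Feasibility of `(X, Y, Z)` in the semidefinite relaxation. Symmetry of `X` and `Y` is part of
the positive semidefiniteness of `Γ`. -/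
structure SdpFeasible {m n : ℕ} (A : Matrix (Fin m) (Fin n) ℝ) (k : ℝ)
    (X Y Z : Matrix (Fin n) (Fin n) ℝ) : Prop where
  kernel : A * X * Aᵀ = 0
  l1_X : entryL1 X ≤ 1
  sup_Y : entrySup Y ≤ 1
  l1_Y : entryL1 Y ≤ k ^ 2
  l1_Z : entryL1 Z ≤ k
  psd : (blockGamma X Y Z).PosSemidef

/-- The objective values `Tr Z` of the semidefinite relaxation. -/
def sdpValues {m n : ℕ} (A : Matrix (Fin m) (Fin n) ℝ) (k : ℝ) : Set ℝ :=
  {t | ∃ X Y Z : Matrix (Fin n) (Fin n) ℝ, SdpFeasible A k X Y Z ∧ t = Z.trace}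

/-- The optimal value `SDP_k` of the semidefinite relaxation. -/
def sdp {m n : ℕ} (A : Matrix (Fin m) (Fin n) ℝ) (k : ℝ) : ℝ := sSup (sdpValues A k)

/-- `(X, Y, Z)` is an optimal solution of the semidefinite relaxation. -/
def IsSdpOptimal {m n : ℕ} (A : Matrix (Fin m) (Fin n) ℝ) (k : ℝ)
    (X Y Z : Matrix (Fin n) (Fin n) ℝ) : Prop :=
  SdpFeasible A k X Y Z ∧
    ∀ X' Y' Z' : Matrix (Fin n) (Fin n) ℝ, SdpFeasible A k X' Y' Z' → Z'.trace ≤ Z.trace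

/-- `δ = 3 + 3 (‖Z‖_F² + Tr (XY)) / ε²`. -/
def delta {n : ℕ} (X Y Z : Matrix (Fin n) (Fin n) ℝ) (ε : ℝ) : ℝ :=
  3 + 3 * (frobSq Z + (X * Y).trace) / ε ^ 2

/-- `g(X, δ)`. -/
def g {n : ℕ} (X : Matrix (Fin n) (Fin n) ℝ) (δ : ℝ) : ℝ :=
  (√(2 / Real.pi) + √(2 * Real.log δ)) * ∑ i, √(X i i)

/-- `h(Y, n, k, δ)`. -/
def h {n : ℕ} (Y : Matrix (Fin n) (Fin n) ℝ) (k δ : ℝ) : ℝ :=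
  max ((√(2 * Real.log (2 * n)) + √(2 * Real.log δ)) * ⨆ i, √(Y i i))
    ((√(2 / Real.pi) + √(2 * Real.log δ)) * (∑ i, √(Y i i)) / k)

/-- The event, for `w = (x, y)`, that the rescaled point `(x / a, y / b)` satisfies `A x / a = 0`,
`‖x / a‖₁ ≤ 1`, `‖y / b‖_∞ ≤ 1`, `‖y / b‖₁ ≤ k` and has objective value
`(y / b)ᵀ (x / a) ≥ v`. -/
def roundingEvent {m n : ℕ} (A : Matrix (Fin m) (Fin n) ℝ) (k a b v : ℝ) :
    Set (EuclideanSpace ℝ (Fin n ⊕ Fin n)) :=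
  {w | ∃ x y : Fin n → ℝ, (∀ i, x i = w (Sum.inl i) / a) ∧ (∀ i, y i = w (Sum.inr i) / b) ∧
    A *ᵥ x = 0 ∧ l1 x ≤ 1 ∧ ‖y‖ ≤ 1 ∧ l1 y ≤ k ∧ v ≤ y ⬝ᵥ x}

end SparseRecovery

end

/-!
The lower bound rests on rounding a Gaussian vector `(x, y)` with covariance `Γ`.

Since `A X Aᵀ = 0`, the vector `A x` has covariance zero, so `A x = 0` almost surely. Three norm
bounds can fail. For `‖x‖₁` and `‖y‖₁`, each norm is `∑ σᵢ |gᵢ|` with standard Gaussians `gᵢ` in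
arbitrary joint position; by convexity of the exponential its moment generating function, after
division by `∑ σᵢ`, is at most that of one `|g|`, which is `2 exp (t² / 2) Φ(t)`, and
`2 Φ(t) ≤ 1 + t √(2 / π) < exp (t √(2 / π))`. This gives the sharp tail with an exponent as in the
Gaussian concentration inequality, without using that inequality, and gives it strictly
(`measureReal_sum_abs_lt_of_gaussian`). For `‖y‖_∞` a union bound over the coordinates suffices.
With the thresholds `g` and `h` each failure has probability at most `1 / δ`.

The form `yᵀx` has mean `Tr Z` and, by Isserlis' formula (`integral_inner_mul_mul_mul`), variance
`Tr (X Y) + Tr (Z²) ≤ V := Tr (X Y) + ‖Z‖_F²`. Cantelli's inequality bounds the probability of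
`yᵀx < Tr Z - ε` by `V / (V + ε²)`. The number `δ` is the one for which
`3 / δ + V / (V + ε²) = 1`, and since two of the bounds are strict, all the events hold together
with positive probability (`roundingEvent_pos`).

A point of that event is feasible for the problem defining `α_k`, except that its norms are only
bounded by `1`. Normalising `x` is harmless. Normalising `y` in the `ℓ^∞` norm might violate
`‖y‖₁ ≤ k`, so mass is moved to the coordinate where `|x|` is largest instead
(`exists_norm_eq_one_dotProduct_ge`). Attainment of both maxima is compactness, and `α_k ≤ SDP_k`
is the rank one lift `(x, y) (x, y)ᵀ`.
-/

namespace SparseRecovery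

/-! ### The two optimisation problems -/

lemma abs_le_l1 {n : ℕ} (x : Fin n → ℝ) (i : Fin n) : |x i| ≤ l1 x :=
  Finset.single_le_sum (f := fun i => |x i|) (fun _ _ => abs_nonneg _) (Finset.mem_univ i)

lemma l1_nonneg {n : ℕ} (x : Fin n → ℝ) : 0 ≤ l1 x :=
  Finset.sum_nonneg fun _ _ => abs_nonneg _

lemma norm_le_l1 {n : ℕ} (x : Fin n → ℝ) : ‖x‖ ≤ l1 x :=
  (pi_norm_le_iff_of_nonneg (l1_nonneg x)).2 fun i => abs_le_l1 x i

lemma l1_pos {n : ℕ} {x : Fin n → ℝ} (hx : x ≠ 0) : 0 < l1 x :=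
  (norm_pos_iff.2 hx).trans_le (norm_le_l1 x)

lemma l1_smul {n : ℕ} (c : ℝ) (x : Fin n → ℝ) : l1 (c • x) = |c| * l1 x := by
  simp [l1, abs_mul, Finset.mul_sum]

lemma continuous_l1 {n : ℕ} : Continuous (l1 : (Fin n → ℝ) → ℝ) := by
  unfold l1; fun_prop

lemma abs_le_entryL1 {n : ℕ} (M : Matrix (Fin n) (Fin n) ℝ) (i j : Fin n) :
    |M i j| ≤ entryL1 M :=
  (abs_le_l1 (M i) j).trans <|
    Finset.single_le_sum (f := fun i => l1 (M i)) (fun _ _ => l1_nonneg _) (Finset.mem_univ i)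

lemma entrySup_le_iff {n : ℕ} {M : Matrix (Fin n) (Fin n) ℝ} {c : ℝ} (hc : 0 ≤ c) :
    entrySup M ≤ c ↔ ∀ i j, |M i j| ≤ c := by
  constructor
  · intro h i j
    exact (le_ciSup (f := fun p : Fin n × Fin n => |M p.1 p.2|) (Set.finite_range _).bddAbove
      (i, j)).trans h
  · intro h
    exact Real.iSup_le (fun p => h p.1 p.2) hc

lemma entryL1_vecMulVec {n : ℕ} (x y : Fin n → ℝ) :
    entryL1 (vecMulVec x y) = l1 x * l1 y := by
  simp [entryL1, l1, vecMulVec_apply, abs_mul, Finset.sum_mul_sum]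

lemma l1_single {n : ℕ} (i : Fin n) (c : ℝ) : l1 (Pi.single i c : Fin n → ℝ) = |c| := by
  unfold l1
  rw [Finset.sum_eq_single i] <;> simp +contextual

lemma norm_single {n : ℕ} (i : Fin n) (c : ℝ) : ‖(Pi.single i c : Fin n → ℝ)‖ = |c| := by
  refine le_antisymm ((norm_le_l1 _).trans_eq (l1_single i c)) ?_
  simpa using norm_le_pi_norm (Pi.single i c : Fin n → ℝ) i

section Problems

variable {m n : ℕ} {A : Matrix (Fin m) (Fin n) ℝ} {k : ℝ}

lemma isCompact_alphaValues (A : Matrix (Fin m) (Fin n) ℝ) (k : ℝ) :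
    IsCompact (alphaValues A k) := by
  let K : Set ((Fin n → ℝ) × (Fin n → ℝ)) :=
    {p | A *ᵥ p.1 = 0 ∧ l1 p.1 = 1 ∧ ‖p.2‖ = 1 ∧ l1 p.2 ≤ k}
  have hK : IsCompact K := by
    refine Metric.isCompact_of_isClosed_isBounded ?_ ?_
    · have hl := continuous_l1 (n := n)
      have hA : Continuous fun p : (Fin n → ℝ) × (Fin n → ℝ) => A *ᵥ p.1 :=
        continuous_const.matrix_mulVec continuous_fst
      exact (isClosed_eq hA continuous_const).inter <|
        (isClosed_eq (hl.comp continuous_fst) continuous_const).inter <|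
        (isClosed_eq continuous_snd.norm continuous_const).inter <|
        isClosed_le (hl.comp continuous_snd) continuous_const
    · refine (Metric.isBounded_closedBall (x := 0) (r := 1)).subset fun p hp => ?_
      rw [mem_closedBall_zero_iff, Prod.norm_def]
      exact max_le ((norm_le_l1 _).trans_eq hp.2.1) hp.2.2.1.le
  have : alphaValues A k = (fun p : (Fin n → ℝ) × (Fin n → ℝ) => p.2 ⬝ᵥ p.1) '' K := by
    ext t
    constructor
    · rintro ⟨x, y, h1, h2, h3, h4, rfl⟩
      exact ⟨(x, y), ⟨h1, h2, h3, h4⟩, rfl⟩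
    · rintro ⟨⟨x, y⟩, ⟨h1, h2, h3, h4⟩, rfl⟩
      exact ⟨x, y, h1, h2, h3, h4, rfl⟩
  rw [this]
  exact hK.image (by simp only [dotProduct]; fun_prop)

lemma exists_pos_mem_alphaValues (hA : ∃ x : Fin n → ℝ, x ≠ 0 ∧ A *ᵥ x = 0) (hk : 1 ≤ k) :
    ∃ t ∈ alphaValues A k, 0 < t := by
  obtain ⟨x, hx, hAx⟩ := hA
  obtain ⟨i, hi⟩ := Function.ne_iff.1 hx
  have hs : |(SignType.sign (x i) : ℝ)| = 1 := by
    rcases lt_or_gt_of_ne hi with h | h <;> simp only [Pi.zero_apply] at h <;> simp [h]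
  refine ⟨_, ⟨(l1 x)⁻¹ • x, Pi.single i (SignType.sign (x i) : ℝ), ?_, ?_, ?_, ?_, rfl⟩, ?_⟩
  · rw [mulVec_smul, hAx, smul_zero]
  · rw [l1_smul, abs_of_nonneg (inv_nonneg.2 (l1_nonneg x)), inv_mul_cancel₀ (l1_pos hx).ne']
  · rw [norm_single, hs]
  · rw [l1_single, hs]; exact hk
  · rw [dotProduct_smul, single_dotProduct, sign_mul_self]
    exact mul_pos (inv_pos.2 (l1_pos hx)) (abs_pos.2 hi)

lemma isGreatest_alpha (hA : ∃ x : Fin n → ℝ, x ≠ 0 ∧ A *ᵥ x = 0) (hk : 1 ≤ k) :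
    IsGreatest (alphaValues A k) (alpha A k) := by
  obtain ⟨t, ht, -⟩ := exists_pos_mem_alphaValues hA hk
  exact (isCompact_alphaValues A k).isGreatest_sSup ⟨t, ht⟩

lemma alpha_pos (hA : ∃ x : Fin n → ℝ, x ≠ 0 ∧ A *ᵥ x = 0) (hk : 1 ≤ k) : 0 < alpha A k := by
  obtain ⟨t, ht, h0⟩ := exists_pos_mem_alphaValues hA hk
  exact h0.trans_le ((isGreatest_alpha hA hk).2 ht)

/-- On the polytope `‖y‖_∞ ≤ 1`, `‖y‖₁ ≤ k` with `1 ≤ k`, a linear functional is dominated by its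
values on the part where `‖y‖_∞ = 1`: mass is moved to the coordinate where the functional is
largest. Plain rescaling of `y` could violate `‖y‖₁ ≤ k`. -/
lemma exists_norm_eq_one_dotProduct_ge {x y : Fin n → ℝ} (hx : x ≠ 0) (hk : 1 ≤ k)
    (hy : ‖y‖ ≤ 1) (hyk : l1 y ≤ k) :
    ∃ y' : Fin n → ℝ, ‖y'‖ = 1 ∧ l1 y' ≤ k ∧ y ⬝ᵥ x ≤ y' ⬝ᵥ x := by
  obtain ⟨j₀, hj₀⟩ := Function.ne_iff.1 hx
  obtain ⟨i, -, hi⟩ := Finset.exists_max_image Finset.univ (fun i => |x i|) ⟨j₀, Finset.mem_univ _⟩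
  replace hi : ∀ j, |x j| ≤ |x i| := fun j => hi j (Finset.mem_univ j)
  have hi0 : 0 < |x i| := (abs_pos.2 hj₀).trans_le (hi j₀)
  set s : ℝ := (SignType.sign (x i) : ℝ)
  have hsx : s * x i = |x i| := sign_mul_self _
  have hs : |s| = 1 := by
    have := congrArg abs hsx
    rw [abs_mul, abs_abs] at this
    exact mul_right_cancel₀ hi0.ne' (by rw [this, one_mul])
  set r : ℝ := ∑ j ∈ Finset.univ.erase i, |y j| with hr
  have hyi : |y i| ≤ 1 := (norm_le_pi_norm y i).trans hy
  have hl : l1 y = |y i| + r := (Finset.add_sum_erase _ _ (Finset.mem_univ i)).symm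
  have hr0 : 0 ≤ r := Finset.sum_nonneg fun _ _ => abs_nonneg _
  -- `q` is the factor by which the coordinates other than `i` shrink
  obtain ⟨q, hq0, hq1, hqk, hqr⟩ :
      ∃ q : ℝ, 0 ≤ q ∧ q ≤ 1 ∧ 1 + q * r ≤ k ∧ (1 - q) * r ≤ 1 - |y i| := by
    rcases le_or_gt (l1 y) 1 with h | h
    · exact ⟨0, le_rfl, zero_le_one, by simpa using hk, by linarith⟩
    · have hr' : 0 < r := by linarith
      have e : (1 - (1 - |y i|) / r) * r = r - (1 - |y i|) := by field_simp
      refine ⟨1 - (1 - |y i|) / r, ?_, ?_, ?_, ?_⟩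
      · rw [sub_nonneg, div_le_one hr']; linarith
      · rw [sub_le_self_iff]; exact div_nonneg (by linarith) hr0
      · rw [e]; linarith
      · rw [sub_mul, e]; linarith
  have hne : ∀ j ∈ Finset.univ.erase i, Function.update (q • y) i s j = q * y j := fun j hj => by
    rw [Function.update_of_ne (Finset.ne_of_mem_erase hj)]; rfl
  refine ⟨Function.update (q • y) i s, le_antisymm ?_ ?_, ?_, ?_⟩
  · refine (pi_norm_le_iff_of_nonneg zero_le_one).2 fun j => ?_
    rw [Real.norm_eq_abs]
    by_cases hj : j = i
    · subst hj; rw [Function.update_self, hs]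
    · rw [hne j (by simp [hj]), abs_mul, abs_of_nonneg hq0]
      exact mul_le_one₀ hq1 (abs_nonneg _) ((norm_le_pi_norm y j).trans hy)
  · have := norm_le_pi_norm (Function.update (q • y) i s) i
    rwa [Function.update_self, Real.norm_eq_abs, hs] at this
  · rw [l1, ← Finset.add_sum_erase _ _ (Finset.mem_univ i), Function.update_self, hs]
    refine le_trans (le_of_eq ?_) hqk
    rw [Finset.mul_sum]
    congr 1
    refine Finset.sum_congr rfl fun j hj => ?_
    rw [hne j hj, abs_mul, abs_of_nonneg hq0]
  · rw [dotProduct, dotProduct, ← Finset.add_sum_erase _ _ (Finset.mem_univ i),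
      ← Finset.add_sum_erase _ (fun j => Function.update (q • y) i s j * x j) (Finset.mem_univ i),
      Function.update_self, hsx]
    have h1 : y i * x i ≤ |y i| * |x i| := by rw [← abs_mul]; exact le_abs_self _
    have h2 : ∑ j ∈ Finset.univ.erase i, y j * x j
        - ∑ j ∈ Finset.univ.erase i, Function.update (q • y) i s j * x j
        ≤ (1 - q) * r * |x i| := by
      rw [← Finset.sum_sub_distrib, hr, Finset.mul_sum, Finset.sum_mul]
      refine Finset.sum_le_sum fun j hj => ?_
      rw [hne j hj, show y j * x j - q * y j * x j = (1 - q) * (y j * x j) by ring, mul_assoc]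
      refine mul_le_mul_of_nonneg_left ?_ (by linarith)
      calc y j * x j ≤ |y j| * |x j| := by rw [← abs_mul]; exact le_abs_self _
        _ ≤ |y j| * |x i| := mul_le_mul_of_nonneg_left (hi j) (abs_nonneg _)
    have h3 := mul_le_mul_of_nonneg_right hqr hi0.le
    linarith

/-- Replacing the normalisations in the definition of `α_k` by inequalities does not increase the
maximum. -/
lemma dotProduct_le_alpha (hA : ∃ x : Fin n → ℝ, x ≠ 0 ∧ A *ᵥ x = 0) (hk : 1 ≤ k)
    {x y : Fin n → ℝ} (hAx : A *ᵥ x = 0) (hx : l1 x ≤ 1) (hy : ‖y‖ ≤ 1) (hyk : l1 y ≤ k) :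
    y ⬝ᵥ x ≤ alpha A k := by
  rcases le_or_gt (y ⬝ᵥ x) 0 with h0 | h0
  · exact h0.trans (alpha_pos hA hk).le
  have hx0 : x ≠ 0 := by rintro rfl; simp at h0
  obtain ⟨y', h1, h2, h3⟩ := exists_norm_eq_one_dotProduct_ge hx0 hk hy hyk
  have hl := l1_pos hx0
  have hmem : y' ⬝ᵥ ((l1 x)⁻¹ • x) ∈ alphaValues A k := by
    refine ⟨_, y', ?_, ?_, h1, h2, rfl⟩
    · rw [mulVec_smul, hAx, smul_zero]
    · rw [l1_smul, abs_of_pos (inv_pos.2 hl), inv_mul_cancel₀ hl.ne']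
  refine le_trans ?_ ((isGreatest_alpha hA hk).2 hmem)
  rw [dotProduct_smul, smul_eq_mul]
  exact h3.trans (le_mul_of_one_le_left (h0.le.trans h3) ((one_le_inv₀ hl).2 hx))

/-- A feasible pair `(x, y)` for `α_k` lifts to the rank one point `(x, y) (x, y)ᵀ` of the
semidefinite program. -/
lemma sdpFeasible_vecMulVec {x y : Fin n → ℝ} (hAx : A *ᵥ x = 0) (hx : l1 x = 1)
    (hy : ‖y‖ = 1) (hyk : l1 y ≤ k) :
    SdpFeasible A k (vecMulVec x x) (vecMulVec y y) (vecMulVec y x) where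
  kernel := by rw [mul_vecMulVec, hAx, zero_vecMulVec, Matrix.zero_mul]
  l1_X := by rw [entryL1_vecMulVec, hx, one_mul]
  sup_Y := by
    refine (entrySup_le_iff zero_le_one).2 fun i j => ?_
    have h : ∀ i, |y i| ≤ 1 := fun i => (norm_le_pi_norm y i).trans_eq hy
    rw [vecMulVec_apply, abs_mul]
    exact mul_le_one₀ (h i) (abs_nonneg _) (h j)
  l1_Y := by
    rw [entryL1_vecMulVec, ← sq]
    exact pow_le_pow_left₀ (l1_nonneg y) hyk 2
  l1_Z := by rwa [entryL1_vecMulVec, hx, mul_one]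
  psd := by
    have h : blockGamma (vecMulVec x x) (vecMulVec y y) (vecMulVec y x)
        = vecMulVec (Sum.elim x y) (star (Sum.elim x y)) := by
      ext (i | i) (j | j) <;> simp [blockGamma, vecMulVec_apply, mul_comm]
    rw [h]
    exact posSemidef_vecMulVec_self_star _

lemma isCompact_sdpValues (A : Matrix (Fin m) (Fin n) ℝ) (hk : 1 ≤ k) :
    IsCompact (sdpValues A k) := by
  let M := Matrix (Fin n) (Fin n) ℝ
  let K : Set (M × M × M) := {p | SdpFeasible A k p.1 p.2.1 p.2.2}
  have hK : IsCompact K := by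
    let B : Set M := Set.pi Set.univ fun _ => Set.pi Set.univ fun _ => Set.Icc (-k) k
    have hB : IsCompact B :=
      isCompact_univ_pi fun _ => isCompact_univ_pi fun _ => isCompact_Icc
    refine (hB.prod (hB.prod hB)).of_isClosed_subset ?_ ?_
    · have e : K = {p | A * p.1 * Aᵀ = 0} ∩ ({p | entryL1 p.1 ≤ 1} ∩ ({p | ∀ i j, |p.2.1 i j| ≤ 1} ∩
          ({p | entryL1 p.2.1 ≤ k ^ 2} ∩ ({p | entryL1 p.2.2 ≤ k} ∩
          ({p | (blockGamma p.1 p.2.1 p.2.2)ᴴ = blockGamma p.1 p.2.1 p.2.2} ∩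
          {p | ∀ u, 0 ≤ star u ⬝ᵥ blockGamma p.1 p.2.1 p.2.2 *ᵥ u}))))) := by
        ext p
        constructor
        · intro h
          exact ⟨h.kernel, h.l1_X, (entrySup_le_iff zero_le_one).1 h.sup_Y, h.l1_Y, h.l1_Z,
            (posSemidef_iff_dotProduct_mulVec.1 h.psd).1,
            (posSemidef_iff_dotProduct_mulVec.1 h.psd).2⟩
        · rintro ⟨h1, h2, h3, h4, h5, h6, h7⟩
          exact ⟨h1, h2, (entrySup_le_iff zero_le_one).2 h3, h4, h5,
            posSemidef_iff_dotProduct_mulVec.2 ⟨h6, h7⟩⟩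
      have hc : ∀ i j, Continuous fun p : M => p i j := fun i j => by fun_prop
      have hl : Continuous (entryL1 : M → ℝ) := by unfold entryL1; fun_prop
      have hG : Continuous fun p : M × M × M => blockGamma p.1 p.2.1 p.2.2 := by
        unfold blockGamma
        exact Continuous.matrix_fromBlocks (by fun_prop) (by fun_prop) (by fun_prop) (by fun_prop)
      rw [e]
      refine (isClosed_eq (by fun_prop) continuous_const).inter <|
        (isClosed_le (by fun_prop) continuous_const).inter <| IsClosed.inter ?_ <|
        (isClosed_le (by fun_prop) continuous_const).inter <|
        (isClosed_le (by fun_prop) continuous_const).inter <|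
        (isClosed_eq (by fun_prop) hG).inter ?_
      · simp only [Set.ofPred_forall]
        exact isClosed_iInter fun i => isClosed_iInter fun j =>
          isClosed_le (by fun_prop) continuous_const
      · simp only [Set.ofPred_forall]
        exact isClosed_iInter fun u => isClosed_le continuous_const
          (Continuous.dotProduct continuous_const (hG.matrix_mulVec continuous_const))
    · have hmem : ∀ N : M, (∀ i j, |N i j| ≤ k) → N ∈ B := fun N hN i _ j _ =>
        abs_le.1 (hN i j)
      intro p hp
      exact ⟨hmem _ fun i j => (abs_le_entryL1 _ i j).trans (hp.l1_X.trans hk),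
        hmem _ fun i j => ((entrySup_le_iff zero_le_one).1 hp.sup_Y i j).trans hk,
        hmem _ fun i j => (abs_le_entryL1 _ i j).trans hp.l1_Z⟩
  have : sdpValues A k = (fun p : M × M × M => p.2.2.trace) '' K := by
    ext t
    constructor
    · rintro ⟨X, Y, Z, h, rfl⟩
      exact ⟨(X, Y, Z), h, rfl⟩
    · rintro ⟨⟨X, Y, Z⟩, h, rfl⟩
      exact ⟨X, Y, Z, h, rfl⟩
  rw [this]
  exact hK.image (by fun_prop)

lemma alphaValues_subset_sdpValues : alphaValues A k ⊆ sdpValues A k := by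
  rintro _ ⟨x, y, h1, h2, h3, h4, rfl⟩
  exact ⟨_, _, _, sdpFeasible_vecMulVec h1 h2 h3 h4, (trace_vecMulVec y x).symm⟩

lemma isGreatest_sdp (hA : ∃ x : Fin n → ℝ, x ≠ 0 ∧ A *ᵥ x = 0) (hk : 1 ≤ k) :
    IsGreatest (sdpValues A k) (sdp A k) := by
  obtain ⟨t, ht, -⟩ := exists_pos_mem_alphaValues hA hk
  exact (isCompact_sdpValues A hk).isGreatest_sSup ⟨t, alphaValues_subset_sdpValues ht⟩

lemma alpha_le_sdp (hA : ∃ x : Fin n → ℝ, x ≠ 0 ∧ A *ᵥ x = 0) (hk : 1 ≤ k) :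
    alpha A k ≤ sdp A k :=
  (isGreatest_sdp hA hk).2 (alphaValues_subset_sdpValues (isGreatest_alpha hA hk).1)

lemma IsSdpOptimal.trace_eq_sdp (hA : ∃ x : Fin n → ℝ, x ≠ 0 ∧ A *ᵥ x = 0) (hk : 1 ≤ k)
    {X Y Z : Matrix (Fin n) (Fin n) ℝ} (hopt : IsSdpOptimal A k X Y Z) :
    Z.trace = sdp A k := by
  refine le_antisymm ((isGreatest_sdp hA hk).2 ⟨X, Y, Z, hopt.1, rfl⟩) ?_
  obtain ⟨X', Y', Z', h', e⟩ := (isGreatest_sdp hA hk).1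
  exact e.trans_le (hopt.2 X' Y' Z' h')

end Problems

/-! ### One-dimensional Gaussian estimates -/

lemma setIntegral_Ioi_gaussianPDFReal_self (μ : ℝ) :
    ∫ u in Set.Ioi μ, gaussianPDFReal μ 1 u = 1 / 2 := by
  have h0 : ∫ u in Set.Ioi (0 : ℝ), gaussianPDFReal 0 1 u = 1 / 2 := by
    have h := integral_comp_abs (f := gaussianPDFReal 0 1)
    have e : ∀ u : ℝ, gaussianPDFReal 0 1 |u| = gaussianPDFReal 0 1 u := fun u => by
      simp [gaussianPDFReal]
    simp_rw [e] at h
    rw [integral_gaussianPDFReal_eq_one 0 one_ne_zero] at h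
    linarith
  rw [← h0, ← integral_indicator measurableSet_Ioi, ← integral_indicator measurableSet_Ioi,
    ← integral_add_right_eq_self _ μ]
  congr 1 with u
  simp [Set.indicator, gaussianPDFReal]

/-- The part of the mass over `(0, t]` is bounded by `t` times the largest value `1 / √(2π)` of the
density. -/
lemma setIntegral_Ioi_zero_gaussianPDFReal_le {t : ℝ} (ht : 0 ≤ t) :
    ∫ u in Set.Ioi 0, gaussianPDFReal t 1 u ≤ 1 / 2 + t * (√(2 * Real.pi))⁻¹ := by
  have hi := integrable_gaussianPDFReal t 1
  rw [← Set.Ioc_union_Ioi_eq_Ioi ht, setIntegral_union (Set.Ioc_disjoint_Ioi le_rfl)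
    measurableSet_Ioi hi.integrableOn hi.integrableOn, setIntegral_Ioi_gaussianPDFReal_self,
    add_comm]
  gcongr
  calc ∫ u in Set.Ioc 0 t, gaussianPDFReal t 1 u
      ≤ ∫ u in Set.Ioc 0 t, (√(2 * Real.pi))⁻¹ := by
        refine setIntegral_mono hi.integrableOn (integrableOn_const (by simp)) fun u => ?_
        simp only [gaussianPDFReal, NNReal.coe_one, mul_one]
        refine mul_le_of_le_one_right (by positivity) (Real.exp_le_one_iff.2 ?_)
        rw [neg_div, neg_nonpos]; positivity
    _ = t * (√(2 * Real.pi))⁻¹ := by simp [ht]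

lemma integrable_exp_mul_abs_gaussianReal (v : NNReal) (t : ℝ) :
    Integrable (fun u => Real.exp (t * |u|)) (gaussianReal 0 v) :=
  integrable_exp_mul_abs (integrable_exp_mul_gaussianReal t) (integrable_exp_mul_gaussianReal (-t))

/-- The moment generating function of `|u|` for a standard Gaussian `u` is
`2 exp (t² / 2) Φ(t)`, where `Φ` is the Gaussian distribution function, and `Φ` lies below its
tangent at `0` on `[0, ∞)`. -/
lemma integral_exp_mul_abs_gaussianReal_le {t : ℝ} (ht : 0 ≤ t) :
    ∫ u, Real.exp (t * |u|) ∂(gaussianReal 0 1)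
      ≤ Real.exp (t ^ 2 / 2) * (1 + t * √(2 / Real.pi)) := by
  have e : ∀ u : ℝ, gaussianPDFReal 0 1 u • Real.exp (t * |u|)
      = Real.exp (t ^ 2 / 2) * gaussianPDFReal t 1 |u| := fun u => by
    simp only [gaussianPDFReal, NNReal.coe_one, mul_one, sub_zero, smul_eq_mul]
    rw [mul_assoc, mul_left_comm (Real.exp (t ^ 2 / 2)), ← Real.exp_add, ← Real.exp_add]
    congr 2
    rw [← sq_abs u]; ring
  rw [integral_gaussianReal_eq_integral_smul one_ne_zero]
  simp_rw [e]
  rw [integral_const_mul, integral_comp_abs (f := gaussianPDFReal t 1)]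
  refine mul_le_mul_of_nonneg_left ?_ (Real.exp_nonneg _)
  have h := setIntegral_Ioi_zero_gaussianPDFReal_le ht
  have h2 : √(2 / Real.pi) = 2 * (√(2 * Real.pi))⁻¹ := by
    have h4 : √(2 / Real.pi) = √(2 ^ 2 * (2 * Real.pi)⁻¹) := by
      congr 1; field_simp
    rw [h4, Real.sqrt_mul (by positivity), Real.sqrt_sq (by norm_num), Real.sqrt_inv]
  rw [h2]
  linarith

lemma integral_pow_four_gaussianReal (v : NNReal) :
    ∫ u, u ^ 4 ∂(gaussianReal 0 v) = 3 * (v : ℝ) ^ 2 := by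
  have h := iteratedDeriv_mgf_zero (X := id) (μ := gaussianReal 0 v) (by simp) 4
  simp only [Pi.pow_apply, id] at h
  rw [← h, mgf_id_gaussianReal]
  -- the derivative of a polynomial times the moment generating function has the same shape
  have hd : ∀ (p p' : ℝ → ℝ), (∀ t, HasDerivAt p (p' t) t) →
      deriv (fun t => p t * Real.exp (0 * t + v * t ^ 2 / 2))
        = fun t => (p' t + p t * (v * t)) * Real.exp (0 * t + v * t ^ 2 / 2) := by
    intro p p' hp
    ext t
    have he : HasDerivAt (fun t : ℝ => 0 * t + v * t ^ 2 / 2) (v * t) t := by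
      have h1 := ((hasDerivAt_id t).const_mul 0).add
        ((((hasDerivAt_id t).pow 2).const_mul (v : ℝ)).div_const 2)
      convert! h1 using 1
      simp; ring
    refine (((hp t).mul he.exp).congr_deriv ?_).deriv
    ring
  have e0 : (fun t : ℝ => Real.exp (0 * t + v * t ^ 2 / 2))
      = fun t => (fun _ => (1 : ℝ)) t * Real.exp (0 * t + v * t ^ 2 / 2) := by simp
  rw [iteratedDeriv_succ', iteratedDeriv_succ', iteratedDeriv_succ', iteratedDeriv_succ',
    iteratedDeriv_zero, e0, hd _ _ (fun t => hasDerivAt_const t 1),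
    hd _ (fun t => v * 1) (fun t => by
      simpa using (hasDerivAt_id t).const_mul (v : ℝ)),
    hd _ (fun t => v ^ 2 * t * 2) (fun t => by
      have h1 := (((hasDerivAt_id t).pow 2).const_mul ((v : ℝ) ^ 2)).const_add (v : ℝ)
      convert! h1 using 1
      · ext s; simp; ring
      · simp; ring),
    hd _ (fun t => 3 * v ^ 2 + v ^ 3 * (3 * t ^ 2)) (fun t => by
      have h1 := ((hasDerivAt_id t).const_mul (3 * (v : ℝ) ^ 2)).add
        (((hasDerivAt_id t).pow 3).const_mul ((v : ℝ) ^ 3))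
      convert! h1 using 1
      · ext s; simp; ring
      · simp; )]
  simp

section Tails

variable {Ω : Type*} {mΩ : MeasurableSpace Ω} {P : Measure Ω}

lemma measureReal_lt_abs_le_of_gaussian [IsProbabilityMeasure P] {X : Ω → ℝ}
    (hXm : Measurable X) {v : NNReal} (hX : P.map X = gaussianReal 0 v) {s : ℝ} (hs : 0 ≤ s) :
    P.real {ω | √v * s < |X ω|} ≤ 2 * Real.exp (-s ^ 2 / 2) := by
  rcases eq_or_ne v 0 with rfl | hv
  · have h0 : P {ω | √((0 : NNReal) : ℝ) * s < |X ω|} = 0 := by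
      have h := Measure.map_apply (μ := P) hXm (measurableSet_singleton (0 : ℝ)).compl
      rw [hX] at h
      simp at h
      refine measure_mono_null (fun ω hω => ?_) h.symm
      simpa using hω
    rw [measureReal_def, h0]
    simp; positivity
  have hv' : 0 < √(v : ℝ) := Real.sqrt_pos.2 (by positivity)
  have key : ∀ Y : Ω → ℝ, Measurable Y → P.map Y = gaussianReal 0 v →
      P.real {ω | √v * s ≤ Y ω} ≤ Real.exp (-s ^ 2 / 2) := by
    intro Y hYm hY
    have hint : Integrable (fun ω => Real.exp (s / √v * Y ω)) P := by
      have := integrable_exp_mul_gaussianReal (μ := 0) (v := v) (s / √v)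
      rw [← hY] at this
      exact this.comp_measurable hYm
    refine (measure_ge_le_exp_mul_mgf _ (by positivity) hint).trans_eq ?_
    rw [mgf_gaussianReal hY, ← Real.exp_add]
    congr 1
    have h2 : (v : ℝ) ≠ 0 := by positivity
    rw [div_pow, Real.sq_sqrt (NNReal.coe_nonneg v)]
    field_simp
    ring
  have hneg : P.map (fun ω => - X ω) = gaussianReal 0 v := by
    rw [show (fun ω => - X ω) = (fun x => -x) ∘ X from rfl, ← Measure.map_map measurable_neg hXm, hX,
      gaussianReal_map_neg, neg_zero]
  have hsub : {ω | √v * s < |X ω|} ⊆ {ω | √v * s ≤ X ω} ∪ {ω | √v * s ≤ - X ω} := by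
    intro ω hω
    have hω' : √v * s < |X ω| := hω
    exact le_abs.1 hω'.le
  have h1 := key X hXm hX
  have h2 := key (fun ω => - X ω) hXm.neg hneg
  have h3 := (measureReal_mono (μ := P) hsub).trans (measureReal_union_le _ _)
  linarith

/-- A weighted average of absolute values of standard Gaussians, which need not be independent.
By convexity of the exponential its moment generating function is at most that of a single one;
the bound is strict since `1 + u < exp u`. -/
lemma measureReal_sum_abs_lt_of_gaussian [IsProbabilityMeasure P] {ι : Type*} [Fintype ι]
    {X : ι → Ω → ℝ} (hXm : ∀ i, Measurable (X i)) {v : ι → NNReal}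
    (hX : ∀ i, P.map (X i) = gaussianReal 0 (v i)) (hv : 0 < ∑ i, √(v i : ℝ)) {t : ℝ} (ht : 0 < t) :
    P.real {ω | (√(2 / Real.pi) + t) * ∑ i, √(v i : ℝ) < ∑ i, |X i ω|}
      < Real.exp (-t ^ 2 / 2) := by
  set W := ∑ i, √(v i : ℝ)
  set G : ι → Ω → ℝ := fun i ω => |X i ω / √(v i : ℝ)|
  set f : Ω → ℝ := fun ω => ∑ i, √(v i : ℝ) / W * Real.exp (t * G i ω) with hf
  have hmgf : ∀ i, Integrable (fun ω => Real.exp (t * G i ω)) P ∧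
      ∫ ω, Real.exp (t * G i ω) ∂P ≤ Real.exp (t ^ 2 / 2) * (1 + t * √(2 / Real.pi)) := by
    intro i
    by_cases hi : v i = 0
    · simp only [G, hi, NNReal.coe_zero, Real.sqrt_zero, div_zero, abs_zero, mul_zero,
        Real.exp_zero]
      refine ⟨integrable_const _, ?_⟩
      simp only [integral_const, probReal_univ, smul_eq_mul, mul_one]
      exact one_le_mul_of_one_le_of_one_le (Real.one_le_exp (by positivity))
        (le_add_of_nonneg_right (by positivity))
    · have hm : P.map (fun ω => X i ω / √(v i : ℝ)) = gaussianReal 0 1 := by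
        rw [show (fun ω => X i ω / √(v i : ℝ)) = (fun x => x / √(v i : ℝ)) ∘ X i from rfl,
          ← Measure.map_map (by fun_prop) (hXm i), hX i, gaussianReal_map_div_const, zero_div]
        congr 1
        ext
        simp [hi]
      have hmeas : Measurable fun ω => X i ω / √(v i : ℝ) := (hXm i).div_const _
      have hI := integrable_exp_mul_abs_gaussianReal 1 t
      have hle := integral_exp_mul_abs_gaussianReal_le ht.le
      rw [← hm] at hI hle
      rw [integral_map hmeas.aemeasurable (by fun_prop)] at hle
      exact ⟨hI.comp_measurable hmeas, hle⟩
  have hfi : Integrable f P := integrable_finsetSum _ fun i _ => (hmgf i).1.const_mul _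
  have hW1 : ∑ i, √(v i : ℝ) / W = 1 := by rw [← Finset.sum_div, div_self hv.ne']
  have hfle : ∫ ω, f ω ∂P ≤ Real.exp (t ^ 2 / 2) * (1 + t * √(2 / Real.pi)) := by
    rw [hf, integral_finsetSum _ fun i _ => (hmgf i).1.const_mul _]
    simp_rw [integral_const_mul]
    calc _ ≤ ∑ i, √(v i : ℝ) / W * (Real.exp (t ^ 2 / 2) * (1 + t * √(2 / Real.pi))) :=
          Finset.sum_le_sum fun i _ => mul_le_mul_of_nonneg_left (hmgf i).2 (by positivity)
      _ = _ := by rw [← Finset.sum_mul, hW1, one_mul]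
  -- coordinates of zero variance vanish almost surely, so that dividing by `√(v i) = 0` is harmless
  have hae : ∀ᵐ ω ∂P, ∀ i, √(v i : ℝ) * G i ω = |X i ω| := by
    rw [ae_all_iff]
    intro i
    by_cases hi : v i = 0
    · have h : ∀ᵐ x ∂(P.map (X i)), x = 0 := by
        rw [hX i, hi, gaussianReal_zero_var, ae_dirac_eq]
        simp
      filter_upwards [ae_of_ae_map (hXm i).aemeasurable h] with ω hω
      simp [hω, hi]
    · refine ae_of_all _ fun ω => ?_
      have : 0 < √(v i : ℝ) := Real.sqrt_pos.2 (by positivity)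
      simp only [G]
      rw [abs_div, abs_of_pos this]
      field_simp
  set c := Real.exp (t * (√(2 / Real.pi) + t)) with hc
  have hsub : {ω | (√(2 / Real.pi) + t) * W < ∑ i, |X i ω|} ≤ᵐ[P] {ω | c ≤ f ω} := by
    filter_upwards [hae] with ω hω hlt
    have hlt' : (√(2 / Real.pi) + t) * W < ∑ i, |X i ω| := hlt
    have hJ := convexOn_exp.map_sum_le (t := Finset.univ) (w := fun i => √(v i : ℝ) / W)
      (p := fun i => t * G i ω) (fun i _ => by positivity) hW1 (fun i _ => Set.mem_univ _)
    refine le_trans (Real.exp_le_exp.2 ?_) hJ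
    have e : ∑ i, (√(v i : ℝ) / W) • (t * G i ω) = t * ((∑ i, |X i ω|) / W) := by
      rw [Finset.sum_div, Finset.mul_sum]
      refine Finset.sum_congr rfl fun i _ => ?_
      rw [← hω i, smul_eq_mul]; ring
    rw [e]
    exact mul_le_mul_of_nonneg_left ((le_div_iff₀ hv).2 hlt'.le) ht.le
  have hmk := mul_meas_ge_le_integral_of_nonneg (μ := P) (f := f)
    (ae_of_all _ fun ω => Finset.sum_nonneg fun i _ => by positivity) hfi c
  have hp : P.real {ω | (√(2 / Real.pi) + t) * W < ∑ i, |X i ω|} ≤ P.real {ω | c ≤ f ω} :=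
    ENNReal.toReal_mono (measure_ne_top _ _) (measure_mono_ae hsub)
  refine hp.trans_lt ?_
  have hc0 : 0 < c := Real.exp_pos _
  refine lt_of_mul_lt_mul_left ?_ hc0.le
  refine (hmk.trans hfle).trans_lt ?_
  have hu : t * √(2 / Real.pi) ≠ 0 := by positivity
  have hlt := Real.add_one_lt_exp hu
  calc Real.exp (t ^ 2 / 2) * (1 + t * √(2 / Real.pi))
      < Real.exp (t ^ 2 / 2) * Real.exp (t * √(2 / Real.pi)) :=
        mul_lt_mul_of_pos_left (by linarith) (Real.exp_pos _)
    _ = c * Real.exp (-t ^ 2 / 2) := by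
        rw [hc, ← Real.exp_add, ← Real.exp_add]
        congr 1
        ring

end Tails

/-! ### Moments of Gaussian vectors -/

section Moments

variable {E : Type*} [NormedAddCommGroup E] [InnerProductSpace ℝ E]

/-- Polarisation of the product of four linear forms. -/
lemma mul_mul_mul_eq_sum_inner_pow_four (a b c d w : E) :
    (inner ℝ a w * inner ℝ b w * (inner ℝ c w * inner ℝ d w) : ℝ) =
      1 / 192 * (inner ℝ (a + b + c + d) w ^ 4 - inner ℝ (a + b + c - d) w ^ 4
        - inner ℝ (a + b - c + d) w ^ 4 + inner ℝ (a + b - c - d) w ^ 4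
        - inner ℝ (a - b + c + d) w ^ 4 + inner ℝ (a - b + c - d) w ^ 4
        + inner ℝ (a - b - c + d) w ^ 4 - inner ℝ (a - b - c - d) w ^ 4) := by
  simp only [inner_add_left, inner_sub_left]
  ring

variable [MeasurableSpace E] [BorelSpace E] {μ : Measure E} [IsGaussian μ]

lemma memLp_inner_of_isGaussian (a : E) (p : ENNReal) (hp : p ≠ ⊤) :
    MemLp (fun w => inner ℝ a w) p μ :=
  IsGaussian.memLp_dual μ (innerSL ℝ a) p hp

lemma integrable_inner_mul_inner (a b : E) :
    Integrable (fun w => inner ℝ a w * inner ℝ b w) μ :=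
  (memLp_inner_of_isGaussian a 2 (by simp)).integrable_mul
    (memLp_inner_of_isGaussian b 2 (by simp))

lemma integrable_inner_pow_four (a : E) : Integrable (fun w => (inner ℝ a w : ℝ) ^ 4) μ := by
  have h := (memLp_inner_of_isGaussian (μ := μ) a (4 : ℕ) (by simp)).integrable_norm_pow (by simp)
  refine h.congr (ae_of_all _ fun w => ?_)
  exact Even.pow_abs (by decide) _

lemma integrable_inner_mul_mul_mul (a b c d : E) :
    Integrable (fun w => (inner ℝ a w * inner ℝ b w * (inner ℝ c w * inner ℝ d w) : ℝ)) μ := by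
  have h := integrable_inner_pow_four (μ := μ)
  simp_rw [mul_mul_mul_eq_sum_inner_pow_four]
  exact ((((((((h _).sub (h _)).sub (h _)).add (h _)).sub (h _)).add (h _)).add (h _)).sub
    (h _)).const_mul _

variable [CompleteSpace E] [SecondCountableTopology E]

lemma integral_inner_of_isGaussian (h0 : ∫ w, w ∂μ = 0) (a : E) : ∫ w, inner ℝ a w ∂μ = 0 := by
  have := integral_inner (𝕜 := ℝ) (μ := μ) (f := id) IsGaussian.integrable_id a
  simpa [h0] using this

lemma map_inner_eq_gaussianReal (h0 : ∫ w, w ∂μ = 0) (a : E) :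
    μ.map (fun w => inner ℝ a w) = gaussianReal 0 (covarianceBilin μ a a).toNNReal := by
  rw [covarianceBilin_self IsGaussian.memLp_two_id, ← integral_inner_of_isGaussian h0 a]
  exact IsGaussian.map_eq_gaussianReal (μ := μ) (innerSL ℝ a)

lemma integral_inner_mul_inner (h0 : ∫ w, w ∂μ = 0) (a b : E) :
    ∫ w, inner ℝ a w * inner ℝ b w ∂μ = covarianceBilin μ a b := by
  rw [covarianceBilin_apply_eq_cov IsGaussian.memLp_two_id, covariance]
  simp only [integral_inner_of_isGaussian h0, sub_zero]

lemma integral_inner_pow_four (h0 : ∫ w, w ∂μ = 0) (a : E) :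
    ∫ w, (inner ℝ a w : ℝ) ^ 4 ∂μ = 3 * (covarianceBilin μ a a) ^ 2 := by
  have h := integral_map (μ := μ) (φ := fun w => inner ℝ a w) (f := fun u : ℝ => u ^ 4)
    (by fun_prop) (by fun_prop)
  rw [← h, map_inner_eq_gaussianReal h0, integral_pow_four_gaussianReal,
    Real.coe_toNNReal _ (covarianceBilin_self_nonneg a)]

/-- Isserlis' formula for fourth moments of a centred Gaussian vector. -/
lemma integral_inner_mul_mul_mul (h0 : ∫ w, w ∂μ = 0) (a b c d : E) :
    ∫ w, (inner ℝ a w * inner ℝ b w * (inner ℝ c w * inner ℝ d w) : ℝ) ∂μ =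
      covarianceBilin μ a b * covarianceBilin μ c d
        + covarianceBilin μ a c * covarianceBilin μ b d
        + covarianceBilin μ a d * covarianceBilin μ b c := by
  have h := integrable_inner_pow_four (μ := μ)
  simp_rw [mul_mul_mul_eq_sum_inner_pow_four]
  rw [integral_const_mul, integral_sub, integral_add, integral_add, integral_sub, integral_add,
    integral_sub, integral_sub]
  on_goal 1 =>
    simp only [integral_inner_pow_four h0, map_add, map_sub, _root_.add_apply,
      _root_.sub_apply]
    rw [covarianceBilin_comm b a, covarianceBilin_comm c a, covarianceBilin_comm d a,
      covarianceBilin_comm c b, covarianceBilin_comm d b, covarianceBilin_comm d c]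
    ring
  all_goals repeat' first | exact h _ | apply Integrable.sub | apply Integrable.add

end Moments

/-! ### Gaussian randomisation -/

/-- One-sided Chebyshev (Cantelli) inequality. -/
lemma measureReal_lt_sub_le_of_secondMoment {Ω : Type*} {mΩ : MeasurableSpace Ω} {P : Measure Ω}
    [IsProbabilityMeasure P] {S : Ω → ℝ} {T V ε : ℝ} (hS : Integrable S P)
    (hS2 : Integrable (fun ω => S ω ^ 2) P) (hT : ∫ ω, S ω ∂P = T)
    (hV : ∫ ω, S ω ^ 2 ∂P ≤ T ^ 2 + V) (hV0 : 0 ≤ V) (hε : 0 < ε) :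
    P.real {ω | S ω < T - ε} ≤ V / (V + ε ^ 2) := by
  -- Markov's inequality for `(S - T - u)²` with the optimal shift `u = V / ε`
  set u := V / ε with hu
  have hu0 : 0 ≤ u := by positivity
  have e : ∀ ω, (S ω - (T + u)) ^ 2 = S ω ^ 2 - 2 * (T + u) * S ω + (T + u) ^ 2 := fun ω => by ring
  have hdiff : Integrable (fun ω => S ω ^ 2 - 2 * (T + u) * S ω) P := hS2.sub (hS.const_mul _)
  have hint : Integrable (fun ω => (S ω - (T + u)) ^ 2) P := by
    simp_rw [e]
    exact hdiff.add (integrable_const _)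
  have hval : ∫ ω, (S ω - (T + u)) ^ 2 ∂P ≤ V + u ^ 2 := by
    simp_rw [e]
    rw [integral_add hdiff (integrable_const _), integral_sub hS2 (hS.const_mul _), integral_const_mul,
      hT]
    simp only [integral_const, probReal_univ, one_smul]
    nlinarith
  have hmk := mul_meas_ge_le_integral_of_nonneg (μ := P)
    (ae_of_all _ fun ω => sq_nonneg (S ω - (T + u))) hint ((ε + u) ^ 2)
  have hsub : {ω | S ω < T - ε} ⊆ {ω | (ε + u) ^ 2 ≤ (S ω - (T + u)) ^ 2} := by
    intro ω hω
    have hω' : S ω < T - ε := hω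
    change (ε + u) ^ 2 ≤ (S ω - (T + u)) ^ 2
    nlinarith
  have hpos : 0 < (ε + u) ^ 2 := by positivity
  calc P.real {ω | S ω < T - ε} ≤ (V + u ^ 2) / (ε + u) ^ 2 := by
        rw [le_div_iff₀' hpos]
        exact (mul_le_mul_of_nonneg_left (measureReal_mono hsub) hpos.le).trans (hmk.trans hval)
    _ = V / (V + ε ^ 2) := by
        have : V + ε ^ 2 ≠ 0 := by positivity
        have h2 : ε + u = (V + ε ^ 2) / ε := by rw [hu]; field_simp; ring
        rw [h2, hu]
        field_simp
        ring

variable {n : ℕ} {X Y Z : Matrix (Fin n) (Fin n) ℝ}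

/-- Every `2 × 2` principal minor of a positive semidefinite matrix is nonnegative. -/
lemma sq_le_mul_of_posSemidef {ι : Type*} {M : Matrix ι ι ℝ} (hM : M.PosSemidef) (i j : ι) :
    M i j ^ 2 ≤ M i i * M j j := by
  have h := (hM.submatrix ![i, j]).det_nonneg
  have hs : M j i = M i j := by simpa using hM.1.apply i j
  rw [det_fin_two] at h
  simp only [submatrix_apply, cons_val_zero, cons_val_one, hs] at h
  nlinarith

lemma sum_sqrt_diag_pos (hΓ : (blockGamma X Y Z).PosSemidef) (hZ : 0 < Z.trace) :
    0 < ∑ i, √(X i i) ∧ 0 < ∑ i, √(Y i i) := by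
  obtain ⟨i, -, hi⟩ : ∃ i ∈ Finset.univ, 0 < Z i i := by
    by_contra! hcon
    exact hZ.not_ge (Finset.sum_nonpos hcon)
  have hsq : Z i i ^ 2 ≤ Y i i * X i i := sq_le_mul_of_posSemidef hΓ (Sum.inr i) (Sum.inl i)
  have hX0 : 0 ≤ X i i := hΓ.diag_nonneg (i := Sum.inl i)
  have hY0 : 0 ≤ Y i i := hΓ.diag_nonneg (i := Sum.inr i)
  have hpos : 0 < Y i i * X i i := (pow_pos hi 2).trans_le hsq
  have hX : X i i ≠ 0 := right_ne_zero_of_mul hpos.ne'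
  have hY : Y i i ≠ 0 := left_ne_zero_of_mul hpos.ne'
  exact ⟨Finset.sum_pos' (fun _ _ => Real.sqrt_nonneg _)
      ⟨i, Finset.mem_univ i, Real.sqrt_pos.2 (hX0.lt_of_ne' hX)⟩,
    Finset.sum_pos' (fun _ _ => Real.sqrt_nonneg _)
      ⟨i, Finset.mem_univ i, Real.sqrt_pos.2 (hY0.lt_of_ne' hY)⟩⟩

lemma trace_mul_self_le_frobSq (Z : Matrix (Fin n) (Fin n) ℝ) : (Z * Z).trace ≤ frobSq Z := by
  have h1 : (Z * Z).trace = ∑ i, ∑ j, Z i j * Z j i := by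
    simp [trace, mul_apply]
  have h2 : frobSq Z = ∑ i, ∑ j, Z j i ^ 2 := Finset.sum_comm
  have h3 : 2 * (Z * Z).trace ≤ frobSq Z + frobSq Z := by
    conv_rhs => rw [h2]
    nth_rewrite 1 [← h2]
    rw [h1, frobSq, Finset.mul_sum, ← Finset.sum_add_distrib]
    refine Finset.sum_le_sum fun i _ => ?_
    rw [Finset.mul_sum, ← Finset.sum_add_distrib]
    exact Finset.sum_le_sum fun j _ => by nlinarith [sq_nonneg (Z i j - Z j i)]
  linarith

/-- The quadratic form `yᵀx` of the Gaussian vector `(x, y)`. -/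
def crossForm (w : EuclideanSpace ℝ (Fin n ⊕ Fin n)) : ℝ := ∑ i, w (Sum.inr i) * w (Sum.inl i)

section

variable {ι : Type*} [Fintype ι] [DecidableEq ι] {S : Matrix ι ι ℝ}

lemma map_apply_multivariateGaussian (hS : S.PosSemidef) (i : ι) :
    (multivariateGaussian 0 S).map (fun w => w i) = gaussianReal 0 (S i i).toNNReal :=
  (measurePreserving_eval_multivariateGaussian hS).map_eq

lemma apply_eq_inner_single (w : EuclideanSpace ℝ ι) (i : ι) :
    w i = inner ℝ (EuclideanSpace.single i (1 : ℝ)) w := by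
  simp [EuclideanSpace.inner_single_left]

lemma covarianceBilin_single (hS : S.PosSemidef) (i j : ι) :
    covarianceBilin (multivariateGaussian 0 S) (EuclideanSpace.single i (1 : ℝ))
      (EuclideanSpace.single j (1 : ℝ)) = S i j := by
  rw [covarianceBilin_multivariateGaussian hS]
  simp

lemma ae_dotProduct_eq_zero (hS : S.PosSemidef) (u : ι → ℝ) (hu : u ⬝ᵥ S *ᵥ u = 0) :
    ∀ᵐ w ∂(multivariateGaussian 0 S), ∑ i, u i * w i = 0 := by
  have h := integral_inner_mul_inner (μ := multivariateGaussian 0 S)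
    integral_id_multivariateGaussian (WithLp.toLp 2 u) (WithLp.toLp 2 u)
  rw [covarianceBilin_multivariateGaussian hS] at h
  have h2 := (integral_eq_zero_iff_of_nonneg (fun w => mul_self_nonneg _)
    (integrable_inner_mul_inner _ _)).1 (h.trans hu)
  filter_upwards [h2] with w hw
  have := mul_self_eq_zero.1 hw
  simpa [PiLp.inner_apply, mul_comm] using this

end

lemma integrable_crossForm (Γ : Matrix (Fin n ⊕ Fin n) (Fin n ⊕ Fin n) ℝ) :
    Integrable crossForm (multivariateGaussian 0 Γ) := by
  unfold crossForm
  refine integrable_finsetSum _ fun i _ => ?_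
  simp_rw [apply_eq_inner_single]
  exact integrable_inner_mul_inner _ _

lemma crossForm_sq (w : EuclideanSpace ℝ (Fin n ⊕ Fin n)) :
    crossForm w ^ 2 = ∑ i, ∑ j,
      w (Sum.inr i) * w (Sum.inl i) * (w (Sum.inr j) * w (Sum.inl j)) := by
  rw [crossForm, sq, Finset.sum_mul_sum]

lemma integrable_crossForm_sq (Γ : Matrix (Fin n ⊕ Fin n) (Fin n ⊕ Fin n) ℝ) :
    Integrable (fun w => crossForm w ^ 2) (multivariateGaussian 0 Γ) := by
  simp_rw [crossForm_sq, apply_eq_inner_single]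
  exact integrable_finsetSum _ fun i _ => integrable_finsetSum _ fun j _ =>
    integrable_inner_mul_mul_mul _ _ _ _

lemma integral_crossForm (hΓ : (blockGamma X Y Z).PosSemidef) :
    ∫ w, crossForm w ∂(multivariateGaussian 0 (blockGamma X Y Z)) = Z.trace := by
  unfold crossForm
  simp_rw [apply_eq_inner_single]
  rw [integral_finsetSum _ fun i _ => integrable_inner_mul_inner _ _]
  refine Finset.sum_congr rfl fun i _ => ?_
  rw [integral_inner_mul_inner integral_id_multivariateGaussian, covarianceBilin_single hΓ]
  rfl

lemma integral_crossForm_sq (hΓ : (blockGamma X Y Z).PosSemidef) :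
    ∫ w, crossForm w ^ 2 ∂(multivariateGaussian 0 (blockGamma X Y Z))
      = Z.trace ^ 2 + ((X * Y).trace + (Z * Z).trace) := by
  simp_rw [crossForm_sq, apply_eq_inner_single]
  rw [integral_finsetSum _ fun i _ => integrable_finsetSum _ fun j _ =>
    integrable_inner_mul_mul_mul _ _ _ _]
  have h : ∀ i, ∫ w, (∑ j, inner ℝ (EuclideanSpace.single (Sum.inr i) (1 : ℝ)) w
      * inner ℝ (EuclideanSpace.single (Sum.inl i) (1 : ℝ)) w
      * (inner ℝ (EuclideanSpace.single (Sum.inr j) (1 : ℝ)) w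
      * inner ℝ (EuclideanSpace.single (Sum.inl j) (1 : ℝ)) w))
      ∂(multivariateGaussian 0 (blockGamma X Y Z))
      = ∑ j, (Z i i * Z j j + (X i j * Y j i + Z i j * Z j i)) := by
    intro i
    rw [integral_finsetSum _ fun j _ => integrable_inner_mul_mul_mul _ _ _ _]
    refine Finset.sum_congr rfl fun j _ => ?_
    rw [integral_inner_mul_mul_mul integral_id_multivariateGaussian]
    simp only [covarianceBilin_single hΓ]
    have hY : Y j i = Y i j := by
      simpa [blockGamma] using hΓ.1.apply (Sum.inr i) (Sum.inr j)
    rw [hY]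
    simp only [blockGamma, fromBlocks_apply₁₁, fromBlocks_apply₁₂, fromBlocks_apply₂₁,
      fromBlocks_apply₂₂, transpose_apply]
    ring
  simp_rw [h, Finset.sum_add_distrib]
  rw [← Finset.sum_mul_sum, ← sq]
  simp [trace, mul_apply]

lemma frobSq_add_trace_nonneg (hΓ : (blockGamma X Y Z).PosSemidef) :
    0 ≤ frobSq Z + (X * Y).trace := by
  have h := variance_nonneg crossForm (multivariateGaussian 0 (blockGamma X Y Z))
  have hm : MemLp crossForm 2 (multivariateGaussian 0 (blockGamma X Y Z)) :=
    (memLp_two_iff_integrable_sq (integrable_crossForm _).aestronglyMeasurable).2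
      (integrable_crossForm_sq _)
  rw [variance_eq_sub hm, integral_crossForm hΓ] at h
  simp only [Pi.pow_apply] at h
  rw [integral_crossForm_sq hΓ] at h
  linarith [trace_mul_self_le_frobSq Z]

lemma three_le_delta (hΓ : (blockGamma X Y Z).PosSemidef) (ε : ℝ) : 3 ≤ delta X Y Z ε := by
  have := frobSq_add_trace_nonneg hΓ
  unfold delta
  have : 0 ≤ 3 * (frobSq Z + (X * Y).trace) / ε ^ 2 := by positivity
  linarith

variable {m : ℕ} {A : Matrix (Fin m) (Fin n) ℝ} {k ε : ℝ}

lemma ae_mulVec_eq_zero (hX : A * X * Aᵀ = 0) (hΓ : (blockGamma X Y Z).PosSemidef) :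
    ∀ᵐ w ∂(multivariateGaussian 0 (blockGamma X Y Z)), A *ᵥ (fun i => w (Sum.inl i)) = 0 := by
  have h : ∀ r, ∀ᵐ w ∂(multivariateGaussian 0 (blockGamma X Y Z)),
      ∑ i, Sum.elim (A r) 0 i * w i = 0 := by
    intro r
    refine ae_dotProduct_eq_zero hΓ _ ?_
    have e : Sum.elim (A r) 0 ⬝ᵥ blockGamma X Y Z *ᵥ Sum.elim (A r) 0 = (A * X * Aᵀ) r r := by
      rw [blockGamma, fromBlocks_mulVec, Matrix.mul_assoc]
      simp [Matrix.mul_apply, dotProduct, mulVec]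
    rw [e, hX]; rfl
  filter_upwards [ae_all_iff.2 h] with w hw
  ext r
  simpa [mulVec, dotProduct] using hw r

/-- With the threshold of `g` (and of the second part of `h`), the `ℓ¹` norm of a group of
coordinates is too large with probability less than `1 / δ`. -/
lemma measureReal_sqrt_mul_lt_l1 {ι : Type*} [Fintype ι] [DecidableEq ι] {S : Matrix ι ι ℝ}
    (hS : S.PosSemidef) (f : Fin n → ι) (hpos : 0 < ∑ i, √(S (f i) (f i))) {δ : ℝ} (hδ : 1 < δ) :
    (multivariateGaussian 0 S).real {w | (√(2 / Real.pi) + √(2 * Real.log δ)) *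
      ∑ i, √(S (f i) (f i)) < l1 fun i => w (f i)} < 1 / δ := by
  have hv : ∀ i, ((S (f i) (f i)).toNNReal : ℝ) = S (f i) (f i) := fun i =>
    Real.coe_toNNReal _ hS.diag_nonneg
  have hlog : 0 < 2 * Real.log δ := mul_pos two_pos (Real.log_pos hδ)
  have h := measureReal_sum_abs_lt_of_gaussian (P := multivariateGaussian 0 S)
    (X := fun i w => w (f i)) (fun i => by fun_prop)
    (fun i => map_apply_multivariateGaussian hS (f i)) (by simpa only [hv] using hpos)
    (Real.sqrt_pos.2 hlog)
  simp only [hv] at h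
  refine h.trans_eq ?_
  rw [Real.sq_sqrt hlog.le, show -(2 * Real.log δ) / 2 = -Real.log δ by ring, Real.exp_neg,
    Real.exp_log (by linarith), one_div]

/-- With the threshold in the first part of `h`, the `ℓ^∞` norm of a group of coordinates is too
large with probability at most `1 / δ`. -/
lemma measureReal_exists_lt_abs {ι : Type*} [Fintype ι] [DecidableEq ι] {S : Matrix ι ι ℝ}
    (hS : S.PosSemidef) (f : Fin n → ι) (hn : 0 < n) {δ : ℝ} (hδ : 1 < δ) :
    (multivariateGaussian 0 S).real {w | ∃ i, (√(2 * Real.log (2 * n)) + √(2 * Real.log δ)) *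
      ⨆ i, √(S (f i) (f i)) < |w (f i)|} ≤ 1 / δ := by
  set s := √(2 * Real.log (2 * n)) + √(2 * Real.log δ)
  have hn' : (1 : ℝ) ≤ n := by exact_mod_cast hn
  have hlog : 0 ≤ 2 * Real.log δ := mul_nonneg two_pos.le (Real.log_nonneg hδ.le)
  have hlogn : 0 ≤ 2 * Real.log (2 * n) :=
    mul_nonneg two_pos.le (Real.log_nonneg (by linarith))
  have hs : 0 ≤ s := by positivity
  -- dropping the cross term of `s²`, each of the `2n` one-sided tails is at most `1 / (2nδ)`
  have hexp : 2 * Real.exp (-s ^ 2 / 2) ≤ 1 / (n * δ) := by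
    have h1 : Real.log (2 * n * δ) ≤ s ^ 2 / 2 := by
      rw [Real.log_mul (by positivity) (by positivity)]
      have h2 := Real.sq_sqrt hlog
      have h3 := Real.sq_sqrt hlogn
      have h4 : 0 ≤ √(2 * Real.log (2 * n)) * √(2 * Real.log δ) := by positivity
      nlinarith
    calc 2 * Real.exp (-s ^ 2 / 2) ≤ 2 * Real.exp (-Real.log (2 * n * δ)) := by
          gcongr; linarith
      _ = 1 / (n * δ) := by
          rw [Real.exp_neg, Real.exp_log (by positivity)]; field_simp
  have hsub : {w : EuclideanSpace ℝ ι | ∃ i, s * ⨆ i, √(S (f i) (f i)) < |w (f i)|} ⊆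
      ⋃ i, {w | √((S (f i) (f i)).toNNReal : ℝ) * s < |w (f i)|} := by
    rintro w ⟨i, hi⟩
    refine Set.mem_iUnion.2 ⟨i, lt_of_le_of_lt ?_ hi⟩
    rw [mul_comm, Real.coe_toNNReal _ hS.diag_nonneg]
    exact mul_le_mul_of_nonneg_left
      (le_ciSup (f := fun i => √(S (f i) (f i))) (Set.finite_range _).bddAbove i) hs
  calc _ ≤ _ := measureReal_mono hsub
    _ ≤ ∑ i, (multivariateGaussian 0 S).real
          {w | √((S (f i) (f i)).toNNReal : ℝ) * s < |w (f i)|} := measureReal_iUnion_fintype_le _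
    _ ≤ ∑ _i : Fin n, 1 / (n * δ) := Finset.sum_le_sum fun i _ =>
          (measureReal_lt_abs_le_of_gaussian (by fun_prop) (map_apply_multivariateGaussian hS (f i))
            hs).trans hexp
    _ = 1 / δ := by
          simp only [Finset.sum_const, Finset.card_univ, Fintype.card_fin, nsmul_eq_mul]
          field_simp

/-- The randomised rounding succeeds with positive probability. The three norm bounds fail with
probability less than `3 / δ` altogether, the bound on `yᵀx` fails with probability at most
`V / (V + ε²)` where `V = ‖Z‖_F² + Tr (XY)`, and `δ` is chosen such that these add up to `1`. -/
lemma roundingEvent_pos (hk : 1 ≤ k) (hε : 0 < ε) (hfeas : SdpFeasible A k X Y Z)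
    (hXpos : 0 < ∑ i, √(X i i)) (hYpos : 0 < ∑ i, √(Y i i))
    (hg : 0 < g X (delta X Y Z ε)) (hh : 0 < h Y k (delta X Y Z ε)) :
    0 < multivariateGaussian 0 (blockGamma X Y Z)
      (roundingEvent A k (g X (delta X Y Z ε)) (h Y k (delta X Y Z ε))
        ((Z.trace - ε) / (g X (delta X Y Z ε) * h Y k (delta X Y Z ε)))) := by
  have hΓ := hfeas.psd
  have hn : 0 < n := by
    rcases Nat.eq_zero_or_pos n with rfl | hn
    · simp at hXpos
    · exact hn
  have hk0 : 0 < k := by linarith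
  set δ := delta X Y Z ε with hδ
  set V := frobSq Z + (X * Y).trace with hV
  have hV0 : 0 ≤ V := frobSq_add_trace_nonneg hΓ
  have hδ3 : 3 ≤ δ := three_le_delta hΓ ε
  have hδV : 3 / δ = ε ^ 2 / (V + ε ^ 2) := by
    have h1 : δ = 3 * (V + ε ^ 2) / ε ^ 2 := by
      rw [hδ, delta, ← hV]; field_simp; ring
    have : V + ε ^ 2 ≠ 0 := by positivity
    rw [h1]; field_simp
  set P := multivariateGaussian 0 (blockGamma X Y Z) with hP
  set a := g X δ
  set b := h Y k δ
  let B₁ : Set (EuclideanSpace ℝ (Fin n ⊕ Fin n)) := {w | a < l1 fun i => w (Sum.inl i)}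
  let B₂ : Set (EuclideanSpace ℝ (Fin n ⊕ Fin n)) := {w | k * b < l1 fun i => w (Sum.inr i)}
  let B₃ : Set (EuclideanSpace ℝ (Fin n ⊕ Fin n)) := {w | ∃ i, b < |w (Sum.inr i)|}
  let B₄ : Set (EuclideanSpace ℝ (Fin n ⊕ Fin n)) := {w | crossForm w < Z.trace - ε}
  have h₁ : P.real B₁ < 1 / δ :=
    measureReal_sqrt_mul_lt_l1 hΓ Sum.inl hXpos (by linarith)
  have h₂ : P.real B₂ < 1 / δ := by
    refine (measureReal_mono ?_).trans_lt
      (measureReal_sqrt_mul_lt_l1 hΓ Sum.inr hYpos (by linarith : 1 < δ))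
    intro w hw
    refine lt_of_le_of_lt ?_ (show k * b < l1 fun i => w (Sum.inr i) from hw)
    have : (√(2 / Real.pi) + √(2 * Real.log δ)) * (∑ i, √(Y i i)) / k ≤ b := le_max_right _ _
    exact (div_le_iff₀' hk0).1 this
  have h₃ : P.real B₃ ≤ 1 / δ := by
    refine (measureReal_mono ?_).trans
      (measureReal_exists_lt_abs hΓ Sum.inr hn (by linarith : 1 < δ))
    rintro w ⟨i, hi⟩
    exact ⟨i, lt_of_le_of_lt (le_max_left _ _) hi⟩
  have h₄ : P.real B₄ ≤ V / (V + ε ^ 2) := by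
    refine measureReal_lt_sub_le_of_secondMoment (integrable_crossForm _)
      (integrable_crossForm_sq _) (integral_crossForm hΓ) ?_ hV0 hε
    rw [integral_crossForm_sq hΓ]
    linarith [trace_mul_self_le_frobSq Z]
  have hN := ae_mulVec_eq_zero hfeas.kernel hΓ
  rw [← hP] at hN
  set R := roundingEvent A k a b ((Z.trace - ε) / (a * b))
  have hcover : (Set.univ : Set _) ≤ᵐ[P] (R ∪ (B₁ ∪ (B₂ ∪ (B₃ ∪ B₄))) : Set _) := by
    filter_upwards [hN] with w hw _
    by_contra hcon
    have hc : ¬ (w ∈ R ∪ (B₁ ∪ (B₂ ∪ (B₃ ∪ B₄)))) := hcon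
    simp only [Set.mem_union, not_or] at hc
    obtain ⟨hR, n₁, n₂, n₃, n₄⟩ := hc
    have n₁' : (l1 fun i => w (Sum.inl i)) ≤ a := not_lt.1 n₁
    have n₂' : (l1 fun i => w (Sum.inr i)) ≤ k * b := not_lt.1 n₂
    have n₃' : ∀ i, |w (Sum.inr i)| ≤ b := fun i => not_lt.1 fun hi => n₃ ⟨i, hi⟩
    have n₄' : Z.trace - ε ≤ crossForm w := not_lt.1 n₄
    refine hR ⟨a⁻¹ • fun i => w (Sum.inl i), b⁻¹ • fun i => w (Sum.inr i), ?_, ?_, ?_, ?_, ?_, ?_,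
      ?_⟩
    · intro i; simp [div_eq_inv_mul]
    · intro i; simp [div_eq_inv_mul]
    · rw [mulVec_smul, hw, smul_zero]
    · rw [l1_smul, abs_of_pos (inv_pos.2 hg), inv_mul_le_iff₀ hg, mul_one]
      exact n₁'
    · rw [norm_smul, Real.norm_eq_abs, abs_of_pos (inv_pos.2 hh), inv_mul_le_iff₀ hh, mul_one]
      exact (pi_norm_le_iff_of_nonneg hh.le).2 n₃'
    · rw [l1_smul, abs_of_pos (inv_pos.2 hh), inv_mul_le_iff₀ hh, mul_comm]
      exact n₂'
    · rw [dotProduct_smul, smul_dotProduct, smul_eq_mul, smul_eq_mul, ← mul_assoc, ← mul_inv,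
        div_eq_inv_mul]
      exact mul_le_mul_of_nonneg_left n₄' (inv_nonneg.2 (mul_pos hg hh).le)
  have htot : 1 ≤ P.real R + (P.real B₁ + (P.real B₂ + (P.real B₃ + P.real B₄))) := by
    have h1 : P.real Set.univ ≤ P.real (R ∪ (B₁ ∪ (B₂ ∪ (B₃ ∪ B₄)))) :=
      ENNReal.toReal_mono (measure_ne_top _ _) (measure_mono_ae hcover)
    rw [probReal_univ] at h1
    linarith [measureReal_union_le (μ := P) R (B₁ ∪ (B₂ ∪ (B₃ ∪ B₄))),
      measureReal_union_le (μ := P) B₁ (B₂ ∪ (B₃ ∪ B₄)),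
      measureReal_union_le (μ := P) B₂ (B₃ ∪ B₄), measureReal_union_le (μ := P) B₃ B₄]
  have hsum : 3 / δ + V / (V + ε ^ 2) = 1 := by
    rw [hδV, ← add_div, add_comm, div_self (by positivity)]
  have h3 : 3 / δ = 1 / δ + 1 / δ + 1 / δ := by ring
  have hR : 0 < P.real R := by linarith
  exact (ENNReal.toReal_pos_iff.1 hR).1

end SparseRecovery

theorem mainTheorem1 {m n : ℕ} (A : Matrix (Fin m) (Fin n) ℝ)
    (hA : ∃ x : Fin n → ℝ, x ≠ 0 ∧ A *ᵥ x = 0)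
    (k : ℝ) (hk : 1 ≤ k) (ε : ℝ) (hε : 0 < ε) :
    IsGreatest (SparseRecovery.alphaValues A k) (SparseRecovery.alpha A k) ∧
    IsGreatest (SparseRecovery.sdpValues A k) (SparseRecovery.sdp A k) ∧
    SparseRecovery.alpha A k ≤ SparseRecovery.sdp A k ∧
    ∀ X Y Z : Matrix (Fin n) (Fin n) ℝ, SparseRecovery.IsSdpOptimal A k X Y Z →
      0 < SparseRecovery.g X (SparseRecovery.delta X Y Z ε) ∧
      0 < SparseRecovery.h Y k (SparseRecovery.delta X Y Z ε) ∧
      (SparseRecovery.sdp A k - ε) /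
          (SparseRecovery.g X (SparseRecovery.delta X Y Z ε) *
            SparseRecovery.h Y k (SparseRecovery.delta X Y Z ε)) ≤ SparseRecovery.alpha A k ∧
      0 < multivariateGaussian 0 (SparseRecovery.blockGamma X Y Z)
        (SparseRecovery.roundingEvent A k
          (SparseRecovery.g X (SparseRecovery.delta X Y Z ε))
          (SparseRecovery.h Y k (SparseRecovery.delta X Y Z ε))
          ((SparseRecovery.sdp A k - ε) /
            (SparseRecovery.g X (SparseRecovery.delta X Y Z ε) *
              SparseRecovery.h Y k (SparseRecovery.delta X Y Z ε)))) := by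
  refine ⟨SparseRecovery.isGreatest_alpha hA hk, SparseRecovery.isGreatest_sdp hA hk,
    SparseRecovery.alpha_le_sdp hA hk, ?_⟩
  intro X Y Z hopt
  have htr := hopt.trace_eq_sdp hA hk
  have hZ : 0 < Z.trace := by
    rw [htr]
    exact (SparseRecovery.alpha_pos hA hk).trans_le (SparseRecovery.alpha_le_sdp hA hk)
  obtain ⟨hX, hY⟩ := SparseRecovery.sum_sqrt_diag_pos hopt.1.psd hZ
  have hk0 : 0 < k := zero_lt_one.trans_le hk
  have hg : 0 < SparseRecovery.g X (SparseRecovery.delta X Y Z ε) :=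
    mul_pos (by positivity) hX
  have hh : 0 < SparseRecovery.h Y k (SparseRecovery.delta X Y Z ε) :=
    lt_max_of_lt_right (div_pos (mul_pos (by positivity) hY) hk0)
  have hpos := SparseRecovery.roundingEvent_pos hk hε hopt.1 hX hY hg hh
  rw [htr] at hpos
  refine ⟨hg, hh, ?_, hpos⟩
  -- an event of positive probability contains a point, and that point is feasible for `α_k`
  obtain ⟨w, x, y, -, -, hAx, hx, hy, hyk, hv⟩ := nonempty_of_measure_ne_zero hpos.ne'
  exact hv.trans (SparseRecovery.dotProduct_le_alpha hA hk hAx hx hy hyk)
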